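/- Let $\mathcal{H}$ be a complex Hilbert space, let $N\geqslant 2$, and let $A_1,\ldots,A_N$ be bounded self-adjoint operators in $\mathcal{H}$ such that $A_iA_j$ is compact for any $i\neq j$. If the range $\mathrm{Ran}(A_i)=\{A_ix\mid x\in\mathcal{H}\}$ is closed for every $i=1,\ldots,N$, then the sum of ranges $$\sum_{i=1}^N \mathrm{Ran}(A_i)=\left\{\sum_{i=1}^N y_i \;\middle|\; y_i\in \mathrm{Ran}(A_i)\right\}$$ is closed in $\mathcal{H}$. -/

import Mathlib

/-! Let `P i` be the orthogonal projection onto `R i = Ran (A i)`. Inverting each `A i` modulo `P i`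
turns compactness of `A i ∘ A j` into compactness of `P i ∘ P j`. Let `S` be the summation map from
the Hilbert sum of the `R i` to `H`, and `T y = (P i y)_i`. Then `T S = 1 + K`, where the entries of
`K` are the off-diagonal `P i ∘ P j`, so `K` is compact. This forces `S` to be bounded below on
`(ker S)ᗮ`, hence to have closed range. -/

/-- A bounded operator on a Hilbert space that has a left inverse modulo compact operators has
closed range. -/
theorem ContinuousLinearMap.isClosed_range_of_comp_eq_id_add_compact {𝕜 E F : Type*} [RCLike 𝕜]
    [NormedAddCommGroup E] [InnerProductSpace 𝕜 E] [CompleteSpace E]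
    [NormedAddCommGroup F] [NormedSpace 𝕜 F]
    (S : E →L[𝕜] F) (T : F →L[𝕜] E) (K : E →L[𝕜] E) (hK : IsCompactOperator K)
    (h : ∀ x, T (S x) = x + K x) : IsClosed (Set.range S) := by
  let V : Submodule 𝕜 E := S.kerᗮ
  have hV : IsClosed (V : Set E) := Submodule.isClosed_orthogonal _
  have : CompleteSpace S.ker := S.isClosed_ker.completeSpace_coe
  have : CompleteSpace V := hV.completeSpace_coe
  have hanti : ∃ c, AntilipschitzWith c (S ∘L V.subtypeL) := by
    rw [antilipschitzWith_iff_exists_mul_le_norm]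
    by_contra! hcon
    have hunit (n : ℕ) : ∃ x ∈ V, ‖x‖ = 1 ∧ ‖S x‖ ≤ 1 / ((n : ℝ) + 1) := by
      obtain ⟨⟨x, hxV⟩, hx⟩ := hcon (1 / ((n : ℝ) + 1)) (by positivity)
      replace hx : ‖S x‖ < 1 / ((n : ℝ) + 1) * ‖x‖ := hx
      have hx0 : 0 < ‖x‖ := by
        rcases (norm_nonneg x).eq_or_lt with h0 | h0
        · rw [← h0, mul_zero] at hx
          exact absurd hx (norm_nonneg _).not_gt
        · exact h0
      refine ⟨((‖x‖⁻¹ : ℝ) : 𝕜) • x, V.smul_mem _ hxV, ?_, ?_⟩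
      · simp [norm_smul, hx0.ne']
      · rw [map_smul, norm_smul, RCLike.norm_ofReal, abs_of_pos (inv_pos.2 hx0),
          inv_mul_le_iff₀ hx0, mul_comm]
        exact hx.le
    choose x hxV hx1 hxS using hunit
    have hS : Filter.Tendsto (fun n => S (x n)) Filter.atTop (nhds 0) :=
      squeeze_zero_norm hxS tendsto_one_div_add_atTop_nhds_zero_nat
    obtain ⟨C, hC, hKC⟩ :=
      IsCompactOperator.image_closedBall_subset_compact (f := (K : E →ₗ[𝕜] E)) hK 1
    obtain ⟨z, -, φ, hφ, hz⟩ := hC.tendsto_subseq (x := fun n => K (x n)) fun n =>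
      hKC ⟨x n, by simp [hx1], rfl⟩
    have hSφ := hS.comp hφ.tendsto_atTop
    -- `x n = T (S x n) - K (x n)`; the limit is then a unit vector in both `ker S` and its
    -- orthogonal complement.
    have hx : Filter.Tendsto (x ∘ φ) Filter.atTop (nhds (-z)) := by
      have := ((T.continuous.tendsto 0).comp hSφ).sub hz
      rw [map_zero, zero_sub] at this
      refine this.congr fun n => ?_
      simp [h]
    have hzV : -z ∈ V := hV.mem_of_tendsto hx (.of_forall fun n => hxV _)
    have hzS : S (-z) = 0 := tendsto_nhds_unique ((S.continuous.tendsto _).comp hx) hSφ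
    have hz1 : ‖-z‖ = 1 :=
      tendsto_nhds_unique hx.norm (tendsto_const_nhds.congr fun n => (hx1 _).symm)
    have hz0 : -z = 0 :=
      inner_self_eq_zero.1 (Submodule.inner_right_of_mem_orthogonal (K := S.ker) hzS hzV)
    simp [hz0] at hz1
  obtain ⟨c, hc⟩ := hanti
  convert hc.isClosed_range (S ∘L V.subtypeL).uniformContinuous using 1
  ext y
  constructor
  · rintro ⟨x, rfl⟩
    refine ⟨⟨x - S.ker.starProjection x, S.ker.sub_starProjection_mem_orthogonal x⟩, ?_⟩
    have : S (S.ker.starProjection x) = 0 := S.ker.starProjection_apply_mem x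
    simp [this]
  · rintro ⟨x, rfl⟩
    exact ⟨x, rfl⟩

section SelfAdjoint

variable {𝕜 H : Type*} [RCLike 𝕜] [NormedAddCommGroup H] [InnerProductSpace 𝕜 H] [CompleteSpace H]

/-- A self-adjoint operator with closed range is invertible modulo the orthogonal projection onto
its range. -/
theorem IsSelfAdjoint.exists_comp_eq_starProjection_range {A : H →L[𝕜] H} (hA : IsSelfAdjoint A)
    [A.range.HasOrthogonalProjection] :
    ∃ C : H →L[𝕜] H, C ∘L A = A.range.starProjection ∧ A ∘L C = A.range.starProjection := by
  have hker : A.rangeᗮ = A.ker := by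
    rw [ContinuousLinearMap.orthogonal_range, ← ContinuousLinearMap.star_eq_adjoint, hA.star_eq]
  set P := A.range.starProjection with hP
  have hAP (x : H) : A (P x) = A x := by
    have : x - P x ∈ A.ker := hker ▸ A.range.sub_starProjection_mem_orthogonal x
    rw [LinearMap.mem_ker, map_sub, sub_eq_zero] at this
    exact this.symm
  have hPA (x : H) : P (A x) = A x :=
    Submodule.starProjection_eq_self_iff.2 ⟨x, rfl⟩
  have hPP (x : H) : P (P x) = P x :=
    Submodule.starProjection_eq_self_iff.2 (A.range.starProjection_apply_mem x)
  -- `B` is `A` on `Ran A` and the identity on `ker A = (Ran A)ᗮ`, hence bijective; its inverse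
  -- serves as `C`.
  let B : H →L[𝕜] H := A + (1 - P)
  have hB (x : H) : B x = A x + (x - P x) := rfl
  have hPB (x : H) : P (B x) = A x := by simp [hB, hPA, hPP]
  have hBP (x : H) : B (P x) = A x := by simp [hB, hAP, hPP]
  have hinj : B.ker = ⊥ := by
    rw [LinearMap.ker_eq_bot']
    intro x hx
    replace hx : B x = 0 := hx
    have hAx : A x = 0 := by rw [← hPB, hx, map_zero]
    have hxP : x = P x := by simpa [hB, hAx, sub_eq_zero] using hx
    have hx' : x ∈ A.rangeᗮ := by rw [hker]; exact hAx
    have hPx : P x = 0 := A.range.starProjection_apply_eq_zero_iff.2 hx'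
    rw [hxP, hPx]
  have hsurj : B.range = ⊤ := by
    rw [LinearMap.range_eq_top]
    intro y
    obtain ⟨u, hu⟩ := A.range.starProjection_apply_mem y
    replace hu : A u = P y := hu
    refine ⟨P u + (y - P y), ?_⟩
    change B _ = y
    simp [hB, hAP, hPP, hu]
  let e := ContinuousLinearEquiv.ofBijective B hinj hsurj
  have he (x : H) : e x = B x := rfl
  refine ⟨e.symm, ?_, ?_⟩ <;> ext x
  · simp [← hBP, ← he]
  · obtain ⟨y, rfl⟩ := e.surjective x
    change A (e.symm (e y)) = P (e y)
    rw [e.symm_apply_apply, he, hPB]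

/-- If a product of self-adjoint operators with closed ranges is compact, then so is the product of
the orthogonal projections onto their ranges. -/
theorem IsCompactOperator.starProjection_range_comp {A B : H →L[𝕜] H}
    (hA : IsSelfAdjoint A) (hB : IsSelfAdjoint B)
    [A.range.HasOrthogonalProjection] [B.range.HasOrthogonalProjection]
    (h : IsCompactOperator (A ∘L B)) :
    IsCompactOperator (A.range.starProjection ∘L B.range.starProjection) := by
  obtain ⟨C, hC, -⟩ := hA.exists_comp_eq_starProjection_range
  obtain ⟨D, -, hD⟩ := hB.exists_comp_eq_starProjection_range
  rw [← hC, ← hD]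
  exact (h.comp_clm D).clm_comp C

/-- The sum of finitely many closed subspaces with pairwise compact products of orthogonal
projections is closed. -/
theorem Submodule.isClosed_range_sum_of_isCompactOperator {ι : Type*} [Fintype ι]
    (R : ι → Submodule 𝕜 H) [∀ i, CompleteSpace (R i)]
    (h : ∀ i j, i ≠ j → IsCompactOperator ((R i).starProjection ∘L (R j).starProjection)) :
    IsClosed (Set.range fun z : ∀ i, R i => ∑ i, (z i : H)) := by
  classical
  -- The exponent 2 gives the direct sum the inner product needed for `(ker S)ᗮ`.
  let e := PiLp.continuousLinearEquiv 2 𝕜 (fun i => R i)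
  let p (j : ι) : PiLp 2 (fun i => R i) →L[𝕜] H :=
    (R j).subtypeL ∘L PiLp.proj 2 (fun i => R i) j
  let S := ∑ i, p i
  let T : H →L[𝕜] PiLp 2 (fun i => R i) :=
    e.symm ∘L ContinuousLinearMap.pi fun i => (R i).orthogonalProjectionOnto
  let q (i : ι) : H →L[𝕜] PiLp 2 (fun i => R i) :=
    e.symm ∘L ContinuousLinearMap.single 𝕜 (fun i => R i) i ∘L (R i).orthogonalProjectionOnto
  -- Both projections are redundant next to `q i` and `p j`; they exhibit the compact factor.
  let k (i j : ι) : PiLp 2 (fun i => R i) →L[𝕜] PiLp 2 (fun i => R i) :=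
    q i ∘L ((R i).starProjection ∘L (R j).starProjection) ∘L p j
  -- The omitted terms `j = i` make up the identity.
  let K := ∑ i, ∑ j ∈ Finset.univ.erase i, k i j
  have hK : IsCompactOperator K := by
    refine Submodule.sum_mem (compactOperator (RingHom.id 𝕜) _ _) fun i _ =>
      Submodule.sum_mem _ fun j hj => ?_
    exact ((h i j (Finset.ne_of_mem_erase hj).symm).comp_clm (p j)).clm_comp (q i)
  have hS (x : PiLp 2 (fun i => R i)) : S x = ∑ i, (x i : H) := by simp [S, p]
  have hTS (x : PiLp 2 (fun i => R i)) : T (S x) = x + K x := by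
    refine PiLp.ext fun i => ?_
    have hT : T (S x) i = ∑ j, (R i).orthogonalProjectionOnto (x j : H) := by
      rw [hS, ← map_sum]
      rfl
    have hk (a j : ι) : k a j x i =
        Pi.single (M := fun i => R i) a ((R a).orthogonalProjectionOnto (x j : H)) i := by
      have hj : (R j).starProjection (x j : H) = x j :=
        Submodule.starProjection_eq_self_iff.2 (x j).2
      have hk' : k a j x i = Pi.single (M := fun i => R i) a ((R a).orthogonalProjectionOnto
          ((R a).starProjection ((R j).starProjection (x j : H)))) i := rfl
      rw [hk', hj, Submodule.orthogonalProjectionOnto_starProjection_of_le le_rfl]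
    have hKx : K x i =
        ∑ j ∈ Finset.univ.erase i, (R i).orthogonalProjectionOnto (x j : H) := by
      have : K x i = ∑ a, ∑ j ∈ Finset.univ.erase a, k a j x i := by simp [K]
      rw [this, Finset.sum_eq_single i]
      · exact Finset.sum_congr rfl fun j _ => by rw [hk, Pi.single_eq_same]
      · exact fun a _ ha => Finset.sum_eq_zero fun j _ => by
          rw [hk, Pi.single_eq_of_ne ha.symm]
      · simp
    rw [hT, PiLp.add_apply, hKx, ← Finset.add_sum_erase _ _ (Finset.mem_univ i),
      Submodule.orthogonalProjectionOnto_mem_subspace_eq_self]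
  convert S.isClosed_range_of_comp_eq_id_add_compact T K hK hTS using 1
  ext y
  constructor
  · rintro ⟨z, rfl⟩
    exact ⟨WithLp.toLp 2 z, hS _⟩
  · rintro ⟨x, rfl⟩
    exact ⟨fun i => x i, (hS x).symm⟩

end SelfAdjoint

theorem mainTheorem4 {H : Type*} [NormedAddCommGroup H] [InnerProductSpace ℂ H] [CompleteSpace H]
    (N : ℕ) (hN : 2 ≤ N) (A : Fin N → H →L[ℂ] H)
    (hA : ∀ i, IsSelfAdjoint (A i))
    (hcomp : ∀ i j, i ≠ j → IsCompactOperator (A i ∘L A j))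
    (hclosed : ∀ i, IsClosed (Set.range (A i))) :
    IsClosed {y : H | ∃ z : Fin N → H, (∀ i, z i ∈ Set.range (A i)) ∧ y = ∑ i, z i} := by
  have (i : Fin N) : CompleteSpace (A i).range := (hclosed i).completeSpace_coe
  convert Submodule.isClosed_range_sum_of_isCompactOperator (fun i => (A i).range)
    fun i j hij => (hcomp i j hij).starProjection_range_comp (hA i) (hA j) using 1
  ext y
  constructor
  · rintro ⟨z, hz, rfl⟩
    exact ⟨fun i => ⟨z i, hz i⟩, rfl⟩
  · rintro ⟨z, rfl⟩
    exact ⟨fun i => z i, fun i => (z i).2, rfl⟩
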